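/- Let $p\ge 3$ be a prime, let $V=\mathbb{C}^{\mathbb{F}_p}$ be the space of complex functions on $\mathbb{F}_p=\mathbb{Z}/p\mathbb{Z}$, let $\mathbb{P}(V)$ be its complex projective space, and let $$T=\{[f]\in\mathbb{P}(V) : |f(x)|=|f(0)|\ \text{for all } x\in\mathbb{F}_p\}$$ be the Clifford torus. Let $F$ be the Fourier transform $(Ff)(k)=\frac{1}{\sqrt p}\sum_{\ell\in\mathbb{F}_p}e^{2i\pi k\ell/p}f(\ell)$, acting on $\mathbb{P}(V)$ by $[f]\mapsto[Ff]$. Set $\theta_0=0$ and $\theta=\arccos\frac{1}{\sqrt p+1}$ if $p\equiv 1 \pmod 4$, and $\theta_0=\theta=\arctan\sqrt p$ if $p\equiv 3\pmod 4$. Let $\chi_0$ be the Legendre character on $\mathbb{F}_p$ (with $\chi_0(0)=0$), and let $h_0$ be the Björck–Saffari function $$h_0=e^{i\theta_0}\delta_0+\cos\theta\,\mathbf{1}_{\mathbb{F}_p^*}+i\sin\theta\,\chi_0 .$$ Then the intersection $T\cap F^{-1}T$ is transverse at $[h_0]$: the point $[h_0]$ belongs to $T\cap F^{-1}T$, and the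 tangent spaces satisfy $T_{[h_0]}T\cap T_{[h_0]}(F^{-1}T)=\{0\}$. -/

import Mathlib

open scoped LinearAlgebra.Projectivization

noncomputable section

namespace BjorckSaffari

section Tangent

variable {V : Type*} [NormedAddCommGroup V] [NormedSpace ℂ V]

/-- The velocities at the point `x` of curves of class `C¹` contained in the subset `S` of the
complex projective space `ℙ ℂ V`. The tangent space of `ℙ ℂ V` at the line `x` is the space
`Hom(x, V / x)`. A curve in `ℙ ℂ V` is given by a lift `γ` to `V ∖ {0}`, and if `γ 0` spans the
line `x`, then the velocity of `t ↦ [γ t]` at `t = 0` is the linear map `x → V / x` that sends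
`γ 0` to the class of `γ' 0`; it does not depend on the lift. -/
def velocities (S : Set (ℙ ℂ V)) (x : ℙ ℂ V) :
    Set (x.submodule →ₗ[ℂ] (V ⧸ x.submodule)) :=
  {φ | ∃ (γ : ℝ → V) (hγ : ∀ t, γ t ≠ 0) (hx : γ 0 ∈ x.submodule),
      ContDiff ℝ 1 γ ∧ (∀ t, Projectivization.mk ℂ (γ t) (hγ t) ∈ S) ∧
      φ ⟨γ 0, hx⟩ = x.submodule.mkQ (deriv γ 0)}

/-- The tangent space at `x` of a subset `S` of the complex projective space: the real vector
space spanned by the velocities at `x` of the curves contained in `S`. When `S` is a submanifold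
and `x` is in `S`, these velocities already form a real vector space, which is the usual
tangent space of `S` at `x`. -/
def tangentSpace (S : Set (ℙ ℂ V)) (x : ℙ ℂ V) :
    Submodule ℝ (x.submodule →ₗ[ℂ] (V ⧸ x.submodule)) :=
  Submodule.span ℝ (velocities S x)

/-- `x` is an intersection point of `S` and `S'`, and the tangent spaces of `S` and `S'` at `x`
intersect only in `0`. -/
def IsTransverseAt (S S' : Set (ℙ ℂ V)) (x : ℙ ℂ V) : Prop :=
  x ∈ S ∩ S' ∧ tangentSpace S x ⊓ tangentSpace S' x = ⊥

end Tangent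

/-- The Clifford torus in the projective space of the space of functions on `ℤ/Nℤ`: the lines
`[f]` such that `|f(k)| = |f(0)|` for all `k`. -/
def cliffordTorus (N : ℕ) : Set (ℙ ℂ (ZMod N → ℂ)) :=
  {x | ∀ f ∈ x.submodule, ∀ k : ZMod N, ‖f k‖ = ‖f 0‖}

/-- The unitary Fourier transform on `ℤ/Nℤ`:
`(F f)(k) = N^{-1/2} ∑_l e^{2iπkl/N} f(l)`. -/
def fourier (N : ℕ) [NeZero N] : (ZMod N → ℂ) →ₗ[ℂ] (ZMod N → ℂ) where
  toFun f k := ((Real.sqrt N : ℝ) : ℂ)⁻¹ * ∑ l : ZMod N, ZMod.stdAddChar (k * l) * f l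
  map_add' f g := by
    funext k
    simp only [Pi.add_apply, mul_add, Finset.sum_add_distrib]
  map_smul' c f := by
    funext k
    simp only [Pi.smul_apply, smul_eq_mul, RingHom.id_apply, Finset.mul_sum]
    exact Finset.sum_congr rfl fun l _ => by ring

theorem fourier_injective (N : ℕ) [NeZero N] : Function.Injective (fourier N) := by
  intro f g hfg
  apply (ZMod.dft (N := N) (E := ℂ)).injective
  funext k
  have hN : ((Real.sqrt N : ℝ) : ℂ)⁻¹ ≠ 0 := by
    have : (0 : ℝ) < N := by exact_mod_cast Nat.pos_of_ne_zero (NeZero.ne N)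
    exact inv_ne_zero (Complex.ofReal_ne_zero.mpr (Real.sqrt_pos.mpr this).ne')
  have h := mul_left_cancel₀ hN (congrFun hfg (-k))
  simp only [ZMod.dft_apply, smul_eq_mul]
  have e : ∀ l : ZMod N, -(l * k) = -k * l := fun l => by ring
  simp only [e]
  exact h

/-- The transformation `[f] ↦ [F f]` of the projective space induced by the Fourier transform. -/
def projFourier (N : ℕ) [NeZero N] : ℙ ℂ (ZMod N → ℂ) → ℙ ℂ (ZMod N → ℂ) :=
  Projectivization.map (fourier N) (fourier_injective N)

/-- The angle `θ`: `arccos (1 / (√p + 1))` if `p ≡ 1 mod 4`, and `arctan √p` otherwise, that is,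
for an odd prime `p`, if `p ≡ 3 mod 4`. -/
def theta (p : ℕ) : ℝ :=
  if p % 4 = 1 then Real.arccos (1 / (Real.sqrt p + 1)) else Real.arctan (Real.sqrt p)

/-- The angle `θ₀`: it is `0` if `p ≡ 1 mod 4`, and `θ₀ = θ` otherwise. -/
def theta₀ (p : ℕ) : ℝ :=
  if p % 4 = 1 then 0 else theta p

/-- The Björck–Saffari function `h₀ = e^{iθ₀} δ₀ + cos θ · 1_{𝔽_p^*} + i sin θ · χ₀`, where `χ₀`
is the Legendre character. -/
def h₀ (p : ℕ) [Fact p.Prime] : ZMod p → ℂ := fun x =>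
  Complex.exp (Complex.I * (theta₀ p : ℝ)) * (if x = 0 then 1 else 0) +
    (Real.cos (theta p) : ℂ) * (if x = 0 then 0 else 1) +
    Complex.I * (Real.sin (theta p) : ℂ) * ((quadraticChar (ZMod p) x : ℤ) : ℂ)

theorem h₀_ne_zero (p : ℕ) [Fact p.Prime] : h₀ p ≠ 0 := by
  intro h
  have h1 := congrFun h 0
  simp [h₀] at h1

end BjorckSaffari

end

namespace BjorckSaffari

/-! Modulo the line of `h₀`, a tangent vector to the torus at `[h₀]` is `i u h₀` with `u` real, and
a tangent vector to its preimage is some `w'` with `F w' = i u' F h₀`, `u'` real. If the two classes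
agree, `F (u h₀) = (u' + const) F h₀`. Parseval makes the constant real, so it can be absorbed in
`u'`. Transversality thus reduces to a rigidity statement (`eq_const_of_fourier_mul_h₀`): if `F (u
h₀) = u' F h₀` with `u`, `u'` real, then `u` is constant.

Off `0`, both `h₀` and `F h₀` are combinations of `1` and the Legendre character `χ₀`. Pairing the
relation and its complex conjugate with `ψ` and `ψ χ₀`, for `ψ ≠ 1, χ₀`, gives four linear equations
linking the coefficients of `u` along `ψ⁻¹`, `ψ⁻¹ χ₀` with those of `u'` along `ψ`, `ψ χ₀`. The
system forces the coefficient of `u` along `ψ⁻¹` to vanish (`sum_mul_inv_eq_zero`). This rests on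
`gaussSum_sq_ne`, the inequality of the squared Gauss sums of `ψ` and `ψ χ₀`, obtained by a Galois
argument; when `p ≡ 1 mod 4` and `ψ` is odd, it rests instead on `cos² θ < sin² θ`.

Hence `u = a + b χ₀` off `0`. Comparing the relation at a square and at a nonsquare then gives `b =
0` and `a = u 0`. -/

/-! ### Galois conjugation and Gauss sums. -/

theorem sum_intCast_mul_pow_eq_zero {ι : Type*} (I : Finset ι) {n T : ℕ} (hn : 0 < n)
    (hT : T.Coprime n) (c : ι → ℤ) (v : ι → ℂ) (hv : ∀ i ∈ I, v i ^ n = 1)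
    (h : ∑ i ∈ I, (c i : ℂ) * v i = 0) : ∑ i ∈ I, (c i : ℂ) * v i ^ T = 0 := by
  have hζ := Complex.isPrimitiveRoot_exp n hn.ne'
  set ζ := Complex.exp (2 * Real.pi * Complex.I / n)
  have : NeZero n := ⟨hn.ne'⟩
  have hex : ∀ i, ∃ j : ℕ, i ∈ I → ζ ^ j = v i := fun i => by
    by_cases hi : i ∈ I
    · obtain ⟨j, -, hj⟩ := hζ.eq_pow_of_pow_eq_one (hv i hi)
      exact ⟨j, fun _ => hj⟩
    · exact ⟨0, fun h => absurd h hi⟩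
  choose j hj using hex
  let f : Polynomial ℤ := ∑ i ∈ I, Polynomial.C (c i) * Polynomial.X ^ j i
  have hf : ∀ z : ℂ, Polynomial.aeval z f = ∑ i ∈ I, (c i : ℂ) * z ^ j i := fun z => by
    simp [f, map_sum]
  have h0 : Polynomial.aeval ζ f = 0 := by
    rw [hf, ← h]
    exact Finset.sum_congr rfl fun i hi => by rw [hj i hi]
  -- `ζ` and `ζ ^ T` have the same minimal polynomial over `ℤ`, so an integral relation at `ζ` also
  -- holds at `ζ ^ T`.
  have hdvd := minpoly.isIntegrallyClosed_dvd (hζ.isIntegral hn) h0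
  rw [hζ.minpoly_eq_pow_coprime hT] at hdvd
  obtain ⟨q, hq⟩ := hdvd
  have h1 : Polynomial.aeval (ζ ^ T) f = 0 := by
    rw [hq, map_mul, minpoly.aeval, zero_mul]
  rw [hf] at h1
  rw [← h1]
  exact Finset.sum_congr rfl fun i hi => by rw [← hj i hi, ← pow_mul, ← pow_mul, mul_comm T]

/-- The Legendre character with complex values. -/
def legendreChar (p : ℕ) [Fact p.Prime] : MulChar (ZMod p) ℂ :=
  (quadraticChar (ZMod p)).ringHomComp (Int.castRingHom ℂ)

variable {p : ℕ} [Fact p.Prime]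

theorem legendreChar_apply (x : ZMod p) :
    legendreChar p x = ((quadraticChar (ZMod p) x : ℤ) : ℂ) := rfl

theorem ringChar_ne_two (hp : 3 ≤ p) : ringChar (ZMod p) ≠ 2 := by
  rw [ZMod.ringChar_zmod_n]
  omega

theorem legendreChar_ne_one (hp : 3 ≤ p) : legendreChar p ≠ 1 :=
  (MulChar.ringHomComp_ne_one_iff (RingHom.injective_int _)).mpr
    (quadraticChar_ne_one (ringChar_ne_two hp))

theorem legendreChar_isQuadratic : (legendreChar p).IsQuadratic :=
  (quadraticChar_isQuadratic (ZMod p)).comp _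

theorem legendreChar_mul_self {x : ZMod p} (hx : x ≠ 0) :
    legendreChar p x * legendreChar p x = 1 := by
  rw [legendreChar_apply]
  exact_mod_cast (sq (quadraticChar (ZMod p) x)).symm.trans (quadraticChar_sq_one hx)

theorem gaussSum_ne_zero {ψ : MulChar (ZMod p) ℂ} (hψ : ψ ≠ 1) :
    gaussSum ψ (ZMod.stdAddChar (N := p)) ≠ 0 :=
  gaussSum_ne_zero_of_nontrivial (by simp [(Fact.out : p.Prime).ne_zero]) hψ
    (ZMod.isPrimitive_stdAddChar p)

theorem gaussSum_mul_star {ψ : MulChar (ZMod p) ℂ} (hψ : ψ ≠ 1) :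
    gaussSum ψ (ZMod.stdAddChar (N := p)) * star (gaussSum ψ (ZMod.stdAddChar (N := p))) = p := by
  rw [star_gaussSum_eq, gaussSum_mul_gaussSum_eq_card hψ (ZMod.isPrimitive_stdAddChar p),
    ZMod.card]

theorem mulChar_pow_sub_one (ψ : MulChar (ZMod p) ℂ) {x : ZMod p} (hx : x ≠ 0) :
    ψ x ^ (p - 1) = 1 := by
  rw [← map_pow, ZMod.pow_card_sub_one_eq_one hx, map_one]

theorem stdAddChar_pow_card (x : ZMod p) : ZMod.stdAddChar x ^ p = (1 : ℂ) := by
  rw [← AddChar.map_nsmul_eq_pow]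
  simp

/-- Conjugating the Gauss sum of `ψ` by an automorphism that fixes the values of `ψ` and moves
those of the additive character shows that it is not an integer multiple of the Gauss sum of
`ψ * legendreChar p`. -/
theorem gaussSum_ne_smul_gaussSum_mul_legendreChar (hp : 3 ≤ p) {ψ : MulChar (ZMod p) ℂ}
    (hψ : ψ ≠ 1) (d : ℤ) :
    gaussSum ψ (ZMod.stdAddChar (N := p)) ≠
      d * gaussSum (ψ * legendreChar p) (ZMod.stdAddChar (N := p)) := by
  intro h
  have hpp : p.Prime := Fact.out
  obtain ⟨t, ht⟩ := quadraticChar_exists_neg_one' (ringChar_ne_two hp)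
  have hcop : p.Coprime (p - 1) := by
    rw [Nat.coprime_self_sub_right (by omega)]
    exact Nat.coprime_one_right p
  -- Raising to the power `T` fixes the `(p - 1)`-th roots of unity, hence the values of `ψ`, and
  -- acts on the `p`-th roots of unity as the power `t`, a nonsquare.
  obtain ⟨T, hT1, hT2⟩ := Nat.chineseRemainder hcop (t : ZMod p).val 1
  have hTt : (T : ZMod p) = t := by
    rw [(ZMod.natCast_eq_natCast_iff _ _ _).mpr hT1, ZMod.natCast_zmod_val]
  have hTcop : T.Coprime (p * (p - 1)) := by
    refine Nat.Coprime.mul_right ?_ ?_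
    · rw [← ZMod.isUnit_iff_coprime, hTt]
      exact t.isUnit
    · have := hT2.gcd_eq
      simpa [Nat.Coprime] using this
  have hpow : ∀ z : ℂ, z ^ (p - 1) = 1 → z ^ T = z := fun z hz => by
    have := pow_eq_pow_mod (M := ℂ) T hz
    rw [this, hT2, ← pow_eq_pow_mod 1 hz, pow_one]
  have key := sum_intCast_mul_pow_eq_zero ({0}ᶜ : Finset (ZMod p)) (n := p * (p - 1)) (T := T)
    (Nat.mul_pos hpp.pos (by omega)) hTcop (fun x => 1 - d * quadraticChar (ZMod p) x)
    (fun x => ψ x * ZMod.stdAddChar x) (fun x hx => by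
      have hx : x ≠ 0 := by simpa using hx
      rw [mul_pow, mul_comm p, pow_mul, mulChar_pow_sub_one ψ hx, mul_comm _ p, pow_mul,
        stdAddChar_pow_card]
      simp)
  have e1 : ∀ a : AddChar (ZMod p) ℂ, ∑ x ∈ ({0}ᶜ : Finset (ZMod p)),
      ((1 - d * quadraticChar (ZMod p) x : ℤ) : ℂ) * (ψ x * a x) =
      gaussSum ψ a - d * gaussSum (ψ * legendreChar p) a := fun a => by
    rw [Finset.sum_subset (Finset.subset_univ _) (fun x _ hx => by
      have hx : x = 0 := by simpa using hx
      simp [hx, MulChar.map_zero]), gaussSum, gaussSum, Finset.mul_sum, ← Finset.sum_sub_distrib]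
    refine Finset.sum_congr rfl fun x _ => ?_
    rw [MulChar.mul_apply, legendreChar_apply]
    push_cast
    ring
  have h2 := key (by rw [e1, h, sub_self])
  have h3 : ∑ x ∈ ({0}ᶜ : Finset (ZMod p)), ((1 - d * quadraticChar (ZMod p) x : ℤ) : ℂ) *
      (ψ x * ZMod.stdAddChar x) ^ T = ∑ x ∈ ({0}ᶜ : Finset (ZMod p)),
      ((1 - d * quadraticChar (ZMod p) x : ℤ) : ℂ) *
      (ψ x * (ZMod.stdAddChar (N := p)).mulShift t x) := by
    refine Finset.sum_congr rfl fun x hx => ?_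
    have hx : x ≠ 0 := by simpa using hx
    rw [mul_pow, hpow _ (mulChar_pow_sub_one ψ hx), ← AddChar.mulShift_spec', hTt]
  rw [h3, e1, gaussSum_mulShift_eq, gaussSum_mulShift_eq, mul_inv, MulChar.mul_apply,
    legendreChar_isQuadratic.inv, legendreChar_apply, ht] at h2
  have hinv : ψ⁻¹ (t : ZMod p) ≠ 0 := (t.isUnit.map ψ⁻¹).ne_zero
  -- As `χ₀ t = -1`, the conjugated relation is the original one with the opposite sign on the
  -- right, up to the factor `ψ⁻¹ t`; adding them leaves only the Gauss sum of `ψ`.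
  have h4 : ψ⁻¹ (t : ZMod p) * (2 * gaussSum ψ (ZMod.stdAddChar (N := p))) = 0 := by
    push_cast at h2
    linear_combination h2 + ψ⁻¹ (t : ZMod p) * h
  exact mul_ne_zero hinv (mul_ne_zero two_ne_zero (gaussSum_ne_zero hψ)) h4

theorem gaussSum_sq_ne (hp : 3 ≤ p) {ψ : MulChar (ZMod p) ℂ} (hψ : ψ ≠ 1) :
    gaussSum ψ (ZMod.stdAddChar (N := p)) ^ 2 ≠
      gaussSum (ψ * legendreChar p) (ZMod.stdAddChar (N := p)) ^ 2 := by
  intro h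
  rcases sq_eq_sq_iff_eq_or_eq_neg.mp h with h | h
  · exact gaussSum_ne_smul_gaussSum_mul_legendreChar hp hψ 1 (by simpa using h)
  · exact gaussSum_ne_smul_gaussSum_mul_legendreChar hp hψ (-1) (by simpa using h)

/-! ### Multiplicative characters as a basis of functions on the nonzero residues. -/

/-- A function on the nonzero residues whose scalar products with all the multiplicative characters
vanish, except for the trivial and the Legendre character, is a combination of these two. -/
theorem exists_eq_add_mul_quadraticChar (hp : 3 ≤ p) (u : ZMod p → ℝ)
    (h : ∀ ψ : MulChar (ZMod p) ℂ, ψ ≠ 1 → ψ ≠ legendreChar p →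
      ∑ x, (u x : ℂ) * ψ⁻¹ x = 0) :
    ∃ a b : ℝ, ∀ y : ZMod p, y ≠ 0 → u y = a + b * (quadraticChar (ZMod p) y : ℤ) := by
  classical
  have hpp : p.Prime := Fact.out
  have htot : ((p.totient : ℝ)) ≠ 0 := by
    exact_mod_cast (Nat.totient_pos.mpr hpp.pos).ne'
  let U : MulChar (ZMod p) ℂ → ℂ := fun ψ => ∑ x, (u x : ℂ) * ψ⁻¹ x
  refine ⟨(U 1).re / p.totient, (U (legendreChar p)).re / p.totient, fun y hy => ?_⟩
  -- Orthogonality of characters inverts the transform `U` at `y`; by hypothesis only two terms of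
  -- the sum survive.
  have e1 : ∑ ψ : DirichletCharacter ℂ p, U ψ * ψ y = p.totient * u y - 0 := by
    have : ∀ x : ZMod p, ∑ ψ : DirichletCharacter ℂ p, (u x : ℂ) * (ψ⁻¹ x * ψ y) =
        if x = y then (p.totient : ℂ) * u y else 0 := fun x => by
      rw [← Finset.mul_sum]
      by_cases hx : x = 0
      · rw [if_neg (by rw [hx]; exact hy.symm)]
        simp [hx, MulChar.map_zero]
      · have := DirichletCharacter.sum_char_inv_mul_char_eq ℂ (isUnit_iff_ne_zero.mpr hx) y
        simp only [MulChar.inv_apply'] at this ⊢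
        rw [this]
        split_ifs with hxy
        · rw [hxy, mul_comm]
        · simp
    simp only [U, Finset.sum_mul, mul_assoc]
    rw [Finset.sum_comm]
    simp [this]
  have e2 : ∑ ψ : DirichletCharacter ℂ p, U ψ * ψ y =
      U 1 + U (legendreChar p) * legendreChar p y := by
    rw [← Finset.sum_subset (Finset.subset_univ ({1, legendreChar p} : Finset _))
      (fun ψ _ hψ => by
        simp only [Finset.mem_insert, Finset.mem_singleton, not_or] at hψ
        rw [show U ψ = 0 from h ψ hψ.1 hψ.2, zero_mul]),
      Finset.sum_pair (legendreChar_ne_one hp).symm, MulChar.one_apply (isUnit_iff_ne_zero.mpr hy),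
      mul_one]
  rw [e1, sub_zero, legendreChar_apply] at e2
  have e3 := congrArg Complex.re e2
  simp only [Complex.mul_re, Complex.add_re, Complex.natCast_re, Complex.natCast_im,
    Complex.ofReal_re, Complex.intCast_re, Complex.intCast_im] at e3
  field_simp
  linarith

/-! ### The angle `θ` and the Fourier transform. -/

theorem cos_theta_mul {p : ℕ} (h : p % 4 = 1) : Real.cos (theta p) * (Real.sqrt p + 1) = 1 := by
  have h0 := Real.sqrt_nonneg p
  rw [theta, if_pos h, Real.cos_arccos]
  · field_simp
  · have : 0 ≤ 1 / (Real.sqrt p + 1) := by positivity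
    linarith
  · rw [div_le_one (by positivity)]
    linarith

theorem sin_theta_eq {p : ℕ} (h : p % 4 = 3) :
    Real.sin (theta p) = Real.sqrt p * Real.cos (theta p) := by
  rw [theta, if_neg (by omega)]
  have := Real.tan_arctan (Real.sqrt p)
  rw [Real.tan_eq_sin_div_cos, div_eq_iff (Real.cos_arctan_pos _).ne'] at this
  exact this

theorem cos_theta_pos {p : ℕ} : 0 < Real.cos (theta p) := by
  by_cases h : p % 4 = 1
  · have h1 := cos_theta_mul h
    have h2 := Real.sqrt_nonneg p
    by_contra! h3
    nlinarith
  · rw [theta, if_neg h]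
    exact Real.cos_arctan_pos _

theorem ofReal_sqrt_mul_self {p : ℕ} : ((Real.sqrt p : ℝ) : ℂ) * ((Real.sqrt p : ℝ) : ℂ) = p := by
  rw [← Complex.ofReal_mul, Real.mul_self_sqrt (by positivity)]
  simp

theorem fourier_apply {N : ℕ} [NeZero N] (f : ZMod N → ℂ) (k : ZMod N) :
    fourier N f k =
      ((Real.sqrt N : ℝ) : ℂ)⁻¹ * ∑ l : ZMod N, ZMod.stdAddChar (k * l) * f l := rfl

theorem star_stdAddChar {N : ℕ} [NeZero N] (x : ZMod N) :
    star (ZMod.stdAddChar x : ℂ) = ZMod.stdAddChar (-x) :=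
  (AddChar.map_neg_eq_conj _ _).symm

theorem star_fourier_apply {N : ℕ} [NeZero N] (f : ZMod N → ℂ) (k : ZMod N) :
    star (fourier N f k) = fourier N (star f) (-k) := by
  simp only [fourier_apply, star_mul', star_sum, star_inv₀, star_stdAddChar, Pi.star_apply, neg_mul]
  congr 2
  exact Complex.conj_ofReal _

theorem sum_fourier_mul_star_fourier {N : ℕ} [NeZero N] (f g : ZMod N → ℂ) :
    ∑ k, fourier N f k * star (fourier N g k) = ∑ l, f l * star (g l) := by
  have hN : (N : ℂ) ≠ 0 := by exact_mod_cast NeZero.ne N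
  have hr : ((Real.sqrt N : ℝ) : ℂ)⁻¹ * ((Real.sqrt N : ℝ) : ℂ)⁻¹ = (N : ℂ)⁻¹ := by
    rw [← mul_inv, ← Complex.ofReal_mul, Real.mul_self_sqrt (by positivity)]
    simp
  have h1 : ∀ k, fourier N f k * star (fourier N g k) =
      (N : ℂ)⁻¹ * ∑ l, ∑ m, f l * star (g m) * ZMod.stdAddChar (k * (l - m)) := fun k => by
    rw [star_fourier_apply, fourier_apply, fourier_apply, mul_mul_mul_comm, hr, Finset.sum_mul_sum]
    congr 1
    refine Finset.sum_congr rfl fun l _ => Finset.sum_congr rfl fun m _ => ?_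
    rw [mul_sub, sub_eq_add_neg, AddChar.map_add_eq_mul, neg_mul, Pi.star_apply]
    ring
  rw [Finset.sum_congr rfl fun k _ => h1 k, ← Finset.mul_sum, Finset.sum_comm, Finset.mul_sum]
  refine Finset.sum_congr rfl fun l _ => ?_
  rw [Finset.sum_comm]
  simp only [← Finset.mul_sum, AddChar.sum_mulShift _ (ZMod.isPrimitive_stdAddChar N), sub_eq_zero,
    ZMod.card]
  simp only [Nat.cast_ite, Nat.cast_zero, mul_ite, mul_zero, Finset.sum_ite_eq, Finset.mem_univ,
    if_true]
  field_simp

theorem sum_mulChar_mul_stdAddChar {ψ : MulChar (ZMod p) ℂ} (hψ : ψ ≠ 1) (l : ZMod p) :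
    ∑ k, ψ k * ZMod.stdAddChar (l * k) = ψ⁻¹ l * gaussSum ψ (ZMod.stdAddChar (N := p)) := by
  by_cases hl : l = 0
  · simp [hl, MulChar.map_zero, MulChar.sum_eq_zero_of_ne_one hψ]
  · have := gaussSum_mulShift_eq ψ (ZMod.stdAddChar (N := p)) (Units.mk0 l hl)
    simpa [gaussSum] using this

theorem sum_fourier_mul_mulChar (f : ZMod p → ℂ) {ψ : MulChar (ZMod p) ℂ} (hψ : ψ ≠ 1) :
    ∑ k, fourier p f k * ψ k = ((Real.sqrt p : ℝ) : ℂ)⁻¹ *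
      gaussSum ψ (ZMod.stdAddChar (N := p)) * ∑ l, f l * ψ⁻¹ l := by
  simp only [fourier_apply, Finset.mul_sum, Finset.sum_mul]
  rw [Finset.sum_comm]
  refine Finset.sum_congr rfl fun l _ => ?_
  rw [show ((Real.sqrt p : ℝ) : ℂ)⁻¹ * gaussSum ψ (ZMod.stdAddChar (N := p)) * (f l * ψ⁻¹ l) =
    ((Real.sqrt p : ℝ) : ℂ)⁻¹ * f l * (ψ⁻¹ l * gaussSum ψ (ZMod.stdAddChar (N := p))) by ring,
    ← sum_mulChar_mul_stdAddChar hψ, Finset.mul_sum]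
  refine Finset.sum_congr rfl fun k _ => ?_
  rw [mul_comm k l]
  ring

/-- Conjugating `F f` reflects its argument, which produces the sign `ψ (-1)`. -/
theorem sum_star_fourier_mul_mulChar (f : ZMod p → ℂ) {ψ : MulChar (ZMod p) ℂ} (hψ : ψ ≠ 1) :
    ∑ k, star (fourier p f k) * ψ k = ψ (-1) * (((Real.sqrt p : ℝ) : ℂ)⁻¹ *
      gaussSum ψ (ZMod.stdAddChar (N := p)) * ∑ l, star (f l) * ψ⁻¹ l) := by
  have := sum_fourier_mul_mulChar (star f) hψ
  simp only [Pi.star_apply] at this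
  rw [← this, Finset.mul_sum, ← Equiv.sum_comp (Equiv.neg (ZMod p))]
  refine Finset.sum_congr rfl fun k _ => ?_
  rw [star_fourier_apply, Equiv.neg_apply, neg_neg, neg_eq_neg_one_mul, map_mul]
  ring

theorem fourier_delta_add_one_add_legendreChar (hp : 3 ≤ p) (z P Q : ℂ) (k : ZMod p) :
    fourier p (fun x => z * (if x = 0 then 1 else 0) + P * (if x = 0 then 0 else 1) +
      Q * legendreChar p x) k =
    ((Real.sqrt p : ℝ) : ℂ)⁻¹ * (z + P * (if k = 0 then (p : ℂ) - 1 else -1) +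
      Q * gaussSum (legendreChar p) (ZMod.stdAddChar (N := p)) * legendreChar p k) := by
  rw [fourier_apply]
  congr 1
  have h1 : ∑ l : ZMod p, ZMod.stdAddChar (k * l) * (legendreChar p l) =
      gaussSum (legendreChar p) (ZMod.stdAddChar (N := p)) * legendreChar p k := by
    have := sum_mulChar_mul_stdAddChar (legendreChar_ne_one hp) k
    rw [legendreChar_isQuadratic.inv] at this
    rw [mul_comm (gaussSum _ _), ← this]
    exact Finset.sum_congr rfl fun _ _ => mul_comm _ _
  have h2 : ∑ l : ZMod p, (ZMod.stdAddChar (k * l) : ℂ) = if k = 0 then (p : ℂ) else 0 := by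
    have := AddChar.sum_mulShift k (ZMod.isPrimitive_stdAddChar p)
    simp only [mul_comm _ k, ZMod.card] at this
    rw [this]
    split_ifs <;> simp
  have h3 : ∀ l : ZMod p, (ZMod.stdAddChar (k * l) : ℂ) * (z * (if l = 0 then 1 else 0) +
      P * (if l = 0 then 0 else 1) + Q * legendreChar p l) =
      (if l = 0 then z - P else 0) + P * ZMod.stdAddChar (k * l) +
      Q * (ZMod.stdAddChar (k * l) * legendreChar p l) := fun l => by
    by_cases hl : l = 0
    · simp [hl, MulChar.map_zero]
    · simp only [hl, if_false]
      ring
  rw [Finset.sum_congr rfl fun l _ => h3 l, Finset.sum_add_distrib, Finset.sum_add_distrib,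
    ← Finset.mul_sum, ← Finset.mul_sum, h1, h2]
  simp only [Finset.sum_ite_eq', Finset.mem_univ, if_true]
  split_ifs <;> ring

/-! ### The quadratic Gauss sum; `h₀` and its Fourier transform are unimodular. -/

theorem mod_four_eq_one_or_three (hp : 3 ≤ p) : p % 4 = 1 ∨ p % 4 = 3 := by
  have := (Fact.out : p.Prime).eq_two_or_odd
  omega

theorem legendreChar_neg_one_of_mod_four_eq_one (hp : 3 ≤ p) (h : p % 4 = 1) :
    legendreChar p (-1) = 1 := by
  rw [legendreChar_apply, quadraticChar_neg_one (ringChar_ne_two hp), ZMod.card,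
    ZMod.χ₄_nat_one_mod_four h, Int.cast_one]

theorem legendreChar_neg_one_of_mod_four_eq_three (hp : 3 ≤ p) (h : p % 4 = 3) :
    legendreChar p (-1) = -1 := by
  rw [legendreChar_apply, quadraticChar_neg_one (ringChar_ne_two hp), ZMod.card,
    ZMod.χ₄_nat_three_mod_four h, Int.cast_neg, Int.cast_one]

/-- The quadratic Gauss sum, up to a sign and to the factor `√p`. -/
def gaussUnit (p : ℕ) : ℂ := if p % 4 = 1 then 1 else Complex.I

theorem norm_gaussUnit (p : ℕ) : ‖gaussUnit p‖ = 1 := by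
  unfold gaussUnit
  split_ifs <;> simp

/-- The square of the quadratic Gauss sum is `χ₀(-1) p`. Its sign `τ` can stay undetermined: only `τ
^ 2 = 1` matters later. -/
theorem exists_gaussSum_legendreChar_eq (hp : 3 ≤ p) : ∃ τ : ℝ, τ ^ 2 = 1 ∧
    ((Real.sqrt p : ℝ) : ℂ)⁻¹ * gaussSum (legendreChar p) (ZMod.stdAddChar (N := p)) =
      τ * gaussUnit p := by
  have hp0 : (p : ℂ) ≠ 0 := by exact_mod_cast (Fact.out : p.Prime).ne_zero
  have hr : (((Real.sqrt p : ℝ) : ℂ)⁻¹) ^ 2 = (p : ℂ)⁻¹ := by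
    rw [inv_pow, ← Complex.ofReal_pow, Real.sq_sqrt (by positivity)]
    simp
  have h1 : (((Real.sqrt p : ℝ) : ℂ)⁻¹ *
      gaussSum (legendreChar p) (ZMod.stdAddChar (N := p))) ^ 2 = gaussUnit p ^ 2 := by
    rw [mul_pow, hr, gaussSum_sq (χ := legendreChar p) (legendreChar_ne_one hp) legendreChar_isQuadratic
      (ZMod.isPrimitive_stdAddChar p), ZMod.card, mul_comm, mul_assoc, mul_inv_cancel₀ hp0, mul_one,
      gaussUnit]
    rcases mod_four_eq_one_or_three hp with h | h
    · rw [legendreChar_neg_one_of_mod_four_eq_one hp h, if_pos h, one_pow]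
    · rw [legendreChar_neg_one_of_mod_four_eq_three hp h, if_neg (by omega), Complex.I_sq]
  rcases sq_eq_sq_iff_eq_or_eq_neg.mp h1 with h | h
  · exact ⟨1, by norm_num, by rw [h]; simp⟩
  · exact ⟨-1, by norm_num, by rw [h]; simp⟩

theorem one_lt_sqrt : 1 < Real.sqrt p := by
  rw [Real.lt_sqrt (by norm_num)]
  have := (Fact.out : p.Prime).one_lt
  exact_mod_cast (by omega)

theorem cos_sq_ne_sin_sq (h : p % 4 = 1) : Real.cos (theta p) ^ 2 < Real.sin (theta p) ^ 2 := by
  have h1 := cos_theta_mul h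
  have h2 := one_lt_sqrt (p := p)
  have h3 := Real.sin_sq_add_cos_sq (theta p)
  have h4 := cos_theta_pos (p := p)
  have : Real.cos (theta p) < 1 / 2 := by nlinarith
  nlinarith

theorem sin_theta_ne_zero (hp : 3 ≤ p) : Real.sin (theta p) ≠ 0 := by
  rcases mod_four_eq_one_or_three hp with h | h
  · intro h0
    have := cos_sq_ne_sin_sq h
    rw [h0] at this
    nlinarith [sq_nonneg (Real.cos (theta p))]
  · rw [sin_theta_eq h]
    have := one_lt_sqrt (p := p)
    exact mul_ne_zero (by linarith) cos_theta_pos.ne'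

theorem h₀_eq : h₀ p = fun x => Complex.exp (Complex.I * (theta₀ p : ℝ)) *
    (if x = 0 then 1 else 0) + (Real.cos (theta p) : ℂ) * (if x = 0 then 0 else 1) +
    Complex.I * (Real.sin (theta p) : ℂ) * legendreChar p x := rfl

theorem h₀_apply {x : ZMod p} (hx : x ≠ 0) : h₀ p x =
    (Real.cos (theta p) : ℂ) + Complex.I * (Real.sin (theta p) : ℂ) * legendreChar p x := by
  simp [h₀_eq, hx]

theorem h₀_zero : h₀ p 0 = Complex.exp (Complex.I * (theta₀ p : ℝ)) := by
  simp [h₀_eq, MulChar.map_zero]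

theorem norm_cos_add_sin_mul_legendreChar {τ : ℝ} (hτ : τ ^ 2 = 1) (t : ℝ) {x : ZMod p}
    (hx : x ≠ 0) : ‖(Real.cos t : ℂ) + Complex.I * (τ * Real.sin t : ℂ) * legendreChar p x‖ = 1 := by
  have h1 : ((quadraticChar (ZMod p) x : ℤ) : ℝ) ^ 2 = 1 := by
    exact_mod_cast quadraticChar_sq_one hx
  have h2 : (Real.cos t : ℂ) + Complex.I * (τ * Real.sin t : ℂ) * legendreChar p x =
      (Real.cos t : ℝ) + (τ * Real.sin t * (quadraticChar (ZMod p) x : ℤ) : ℝ) * Complex.I := by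
    rw [legendreChar_apply]
    push_cast
    ring
  rw [h2, Complex.norm_add_mul_I, Real.sqrt_eq_one]
  linear_combination Real.sin_sq_add_cos_sq t + Real.sin t ^ 2 * (hτ + τ ^ 2 * h1)

theorem norm_h₀ (x : ZMod p) : ‖h₀ p x‖ = 1 := by
  by_cases hx : x = 0
  · rw [hx, h₀_zero, mul_comm, Complex.norm_exp_ofReal_mul_I]
  · rw [h₀_apply hx]
    simpa using norm_cos_add_sin_mul_legendreChar (τ := 1) (by norm_num) (theta p) hx

theorem ofReal_sqrt_ne_zero : ((Real.sqrt p : ℝ) : ℂ) ≠ 0 :=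
  Complex.ofReal_ne_zero.mpr (by linarith [one_lt_sqrt (p := p)])

/-- The angles are chosen so that `e^{iθ₀} - cos θ = √p · gaussUnit p · cos θ`. Up to a unimodular
factor and the sign `τ`, `F h₀` then has the same form as `h₀` off `0`. -/
theorem fourier_h₀_apply (hp : 3 ≤ p) {τ : ℝ}
    (hτ : ((Real.sqrt p : ℝ) : ℂ)⁻¹ * gaussSum (legendreChar p) (ZMod.stdAddChar (N := p)) =
      τ * gaussUnit p) {k : ZMod p} (hk : k ≠ 0) :
    fourier p (h₀ p) k = gaussUnit p * ((Real.cos (theta p) : ℂ) +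
      Complex.I * (τ * Real.sin (theta p) : ℂ) * legendreChar p k) := by
  rw [h₀_eq, fourier_delta_add_one_add_legendreChar hp, if_neg hk]
  have hr := ofReal_sqrt_ne_zero (p := p)
  suffices ((Real.sqrt p : ℝ) : ℂ)⁻¹ * (Complex.exp (Complex.I * (theta₀ p : ℝ)) -
      (Real.cos (theta p) : ℂ)) = gaussUnit p * (Real.cos (theta p) : ℂ) by
    linear_combination this + Complex.I * (Real.sin (theta p) : ℂ) * legendreChar p k * hτ
  rw [inv_mul_eq_iff_eq_mul₀ hr]
  rcases mod_four_eq_one_or_three hp with h | h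
  · have h1 : (Real.cos (theta p) : ℂ) * ((Real.sqrt p : ℝ) + 1) = 1 := by
      exact_mod_cast cos_theta_mul h
    rw [theta₀, if_pos h, gaussUnit, if_pos h]
    simp only [Complex.ofReal_zero, mul_zero, Complex.exp_zero]
    linear_combination -h1
  · have h1 : (Real.sin (theta p) : ℂ) = (Real.sqrt p : ℝ) * (Real.cos (theta p) : ℂ) := by
      exact_mod_cast sin_theta_eq h
    rw [theta₀, if_neg (by omega), gaussUnit, if_neg (by omega), mul_comm Complex.I,
      Complex.exp_mul_I, ← Complex.ofReal_cos, ← Complex.ofReal_sin, h1]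
    ring

theorem norm_fourier_h₀ (hp : 3 ≤ p) (k : ZMod p) : ‖fourier p (h₀ p) k‖ = 1 := by
  by_cases hk : k = 0
  · rw [hk, h₀_eq, fourier_delta_add_one_add_legendreChar hp, if_pos rfl, MulChar.map_zero,
      mul_zero, add_zero]
    have hr := ofReal_sqrt_ne_zero (p := p)
    have hrr := ofReal_sqrt_mul_self (p := p)
    rcases mod_four_eq_one_or_three hp with h | h
    · have h1 : (Real.cos (theta p) : ℂ) * ((Real.sqrt p : ℝ) + 1) = 1 := by
        exact_mod_cast cos_theta_mul h
      rw [theta₀, if_pos h]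
      simp only [Complex.ofReal_zero, mul_zero, Complex.exp_zero]
      suffices ((Real.sqrt p : ℝ) : ℂ)⁻¹ * (1 + (Real.cos (theta p) : ℂ) * (p - 1)) = 1 by
        rw [this, norm_one]
      rw [inv_mul_eq_iff_eq_mul₀ hr, ← hrr]
      linear_combination ((Real.sqrt p : ℝ) - 1 : ℂ) * h1
    · have h1 : (Real.sin (theta p) : ℂ) = (Real.sqrt p : ℝ) * (Real.cos (theta p) : ℂ) := by
        exact_mod_cast sin_theta_eq h
      suffices ((Real.sqrt p : ℝ) : ℂ)⁻¹ * (Complex.exp (Complex.I * (theta₀ p : ℝ)) +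
          (Real.cos (theta p) : ℂ) * (p - 1)) =
          (Real.sin (theta p) : ℂ) + (Real.cos (theta p) : ℂ) * Complex.I by
        rw [this, Complex.norm_add_mul_I, Real.sin_sq_add_cos_sq, Real.sqrt_one]
      rw [theta₀, if_neg (by omega), mul_comm Complex.I,
        Complex.exp_mul_I, ← Complex.ofReal_cos, ← Complex.ofReal_sin, h1,
        inv_mul_eq_iff_eq_mul₀ hr, ← hrr]
      ring
  · obtain ⟨τ, hτ, hg⟩ := exists_gaussSum_legendreChar_eq hp
    rw [fourier_h₀_apply hp hg hk, norm_mul, norm_gaussUnit, one_mul,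
      norm_cos_add_sin_mul_legendreChar hτ _ hk]

theorem mulChar_neg_one_eq (ψ : MulChar (ZMod p) ℂ) : ψ (-1) = 1 ∨ ψ (-1) = -1 := by
  rw [← sq_eq_one_iff, ← map_pow, neg_one_sq, map_one]

theorem legendreChar_mul_legendreChar : legendreChar p * legendreChar p = 1 := by
  rw [← sq, legendreChar_isQuadratic.sq_eq_one]

theorem norm_gaussSum_eq {ψ φ : MulChar (ZMod p) ℂ} (hψ : ψ ≠ 1) (hφ : φ ≠ 1) :
    ‖gaussSum ψ (ZMod.stdAddChar (N := p))‖ = ‖gaussSum φ (ZMod.stdAddChar (N := p))‖ := by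
  have h : ∀ {ψ : MulChar (ZMod p) ℂ}, ψ ≠ 1 →
      ‖gaussSum ψ (ZMod.stdAddChar (N := p))‖ ^ 2 = p := fun hψ => by
    have := congrArg norm (gaussSum_mul_star hψ)
    rwa [norm_mul, norm_star, ← sq, Complex.norm_natCast] at this
  exact (pow_left_inj₀ (norm_nonneg _) (norm_nonneg _) two_ne_zero).mp ((h hψ).trans (h hφ).symm)

/-! ### Pairing the relation `F (u h₀) = u' F h₀` with multiplicative characters. -/

section Mellin

variable {u u' : ZMod p → ℝ} {τ : ℝ}

theorem ofReal_mul_star_mul (a c s q : ℝ) (τ : ℝ) :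
    star ((a : ℂ) * ((c : ℂ) + Complex.I * (τ * s : ℂ) * (q : ℂ))) =
      a * ((c : ℂ) - Complex.I * (τ * s : ℂ) * (q : ℂ)) := by
  simp only [Complex.star_def, map_mul, map_add, Complex.conj_ofReal, Complex.conj_I]
  ring

theorem sum_ofReal_mul_h₀_mul (u : ZMod p → ℝ) (ψ : MulChar (ZMod p) ℂ) :
    ∑ x, (u x : ℂ) * h₀ p x * ψ x = Real.cos (theta p) * ∑ x, (u x : ℂ) * ψ x +
      Complex.I * Real.sin (theta p) * ∑ x, (u x : ℂ) * (ψ * legendreChar p) x := by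
  rw [Finset.mul_sum, Finset.mul_sum, ← Finset.sum_add_distrib]
  refine Finset.sum_congr rfl fun x _ => ?_
  by_cases hx : x = 0
  · simp [hx, MulChar.map_zero]
  · rw [h₀_apply hx, MulChar.mul_apply]
    ring

theorem sum_star_ofReal_mul_h₀_mul (u : ZMod p → ℝ) (ψ : MulChar (ZMod p) ℂ) :
    ∑ x, star ((u x : ℂ) * h₀ p x) * ψ x = Real.cos (theta p) * ∑ x, (u x : ℂ) * ψ x -
      Complex.I * Real.sin (theta p) * ∑ x, (u x : ℂ) * (ψ * legendreChar p) x := by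
  rw [Finset.mul_sum, Finset.mul_sum, ← Finset.sum_sub_distrib]
  refine Finset.sum_congr rfl fun x _ => ?_
  by_cases hx : x = 0
  · simp [hx, MulChar.map_zero]
  · have := ofReal_mul_star_mul (u x) (Real.cos (theta p)) (Real.sin (theta p))
      ((quadraticChar (ZMod p) x : ℤ) : ℝ) 1
    rw [h₀_apply hx, MulChar.mul_apply, legendreChar_apply]
    simp only [Complex.ofReal_one, one_mul, Complex.ofReal_intCast] at this
    rw [this]
    ring

theorem mellin_eq (hp : 3 ≤ p)
    (hτ : ((Real.sqrt p : ℝ) : ℂ)⁻¹ * gaussSum (legendreChar p) (ZMod.stdAddChar (N := p)) =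
      τ * gaussUnit p)
    (hF : ∀ k, fourier p (fun x => (u x : ℂ) * h₀ p x) k = u' k * fourier p (h₀ p) k)
    {ψ : MulChar (ZMod p) ℂ} (hψ : ψ ≠ 1) :
    ((Real.sqrt p : ℝ) : ℂ)⁻¹ * gaussSum ψ (ZMod.stdAddChar (N := p)) *
      (Real.cos (theta p) * ∑ x, (u x : ℂ) * ψ⁻¹ x +
        Complex.I * Real.sin (theta p) * ∑ x, (u x : ℂ) * (ψ⁻¹ * legendreChar p) x) =
    gaussUnit p * (Real.cos (theta p) * ∑ k, (u' k : ℂ) * ψ k +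
        Complex.I * (τ * Real.sin (theta p)) * ∑ k, (u' k : ℂ) * (ψ * legendreChar p) k) := by
  rw [← sum_ofReal_mul_h₀_mul, ← sum_fourier_mul_mulChar _ hψ, Finset.mul_sum, Finset.mul_sum,
    ← Finset.sum_add_distrib, Finset.mul_sum]
  refine Finset.sum_congr rfl fun k _ => ?_
  by_cases hk : k = 0
  · simp [hk, MulChar.map_zero]
  · rw [hF, fourier_h₀_apply hp hτ hk, MulChar.mul_apply]
    ring

/-- Since `u` and `u'` are real, the conjugate relation involves the same four sums as `mellin_eq`
with the sine terms negated; half-sums and half-differences of the two separate cosine and sine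
terms. -/
theorem mellin_star_eq (hp : 3 ≤ p)
    (hτ : ((Real.sqrt p : ℝ) : ℂ)⁻¹ * gaussSum (legendreChar p) (ZMod.stdAddChar (N := p)) =
      τ * gaussUnit p)
    (hF : ∀ k, fourier p (fun x => (u x : ℂ) * h₀ p x) k = u' k * fourier p (h₀ p) k)
    {ψ : MulChar (ZMod p) ℂ} (hψ : ψ ≠ 1) :
    ψ (-1) * (((Real.sqrt p : ℝ) : ℂ)⁻¹ * gaussSum ψ (ZMod.stdAddChar (N := p)) *
      (Real.cos (theta p) * ∑ x, (u x : ℂ) * ψ⁻¹ x -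
        Complex.I * Real.sin (theta p) * ∑ x, (u x : ℂ) * (ψ⁻¹ * legendreChar p) x)) =
    star (gaussUnit p) * (Real.cos (theta p) * ∑ k, (u' k : ℂ) * ψ k -
        Complex.I * (τ * Real.sin (theta p)) * ∑ k, (u' k : ℂ) * (ψ * legendreChar p) k) := by
  rw [← sum_star_ofReal_mul_h₀_mul, ← sum_star_fourier_mul_mulChar _ hψ, Finset.mul_sum,
    Finset.mul_sum, ← Finset.sum_sub_distrib, Finset.mul_sum]
  refine Finset.sum_congr rfl fun k _ => ?_
  by_cases hk : k = 0
  · simp [hk, MulChar.map_zero]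
  · have := ofReal_mul_star_mul (u' k) (Real.cos (theta p)) (Real.sin (theta p))
      ((quadraticChar (ZMod p) k : ℤ) : ℝ) τ
    rw [hF, fourier_h₀_apply hp hτ hk, MulChar.mul_apply, mul_left_comm, star_mul',
      legendreChar_apply]
    simp only [Complex.ofReal_intCast] at this
    rw [this]
    ring

end Mellin

/-! ### Solving the linear systems. -/

section Algebra

variable {A B A' B' G₁ G₂ : ℂ} {c s τ : ℝ}

theorem eq_zero_of_mul_sq_sub_sq (hG : G₁ ^ 2 ≠ G₂ ^ 2) (h : A * (G₁ ^ 2 - G₂ ^ 2) = 0) : A = 0 :=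
  (mul_eq_zero.mp h).resolve_right (sub_ne_zero.mpr hG)

theorem eq_zero_of_one_of_even (hc : c ≠ 0) (hs : s ≠ 0) (hτ : τ ^ 2 = 1) (hG : G₁ ^ 2 ≠ G₂ ^ 2)
    (e₁ : G₁ * (c * A + Complex.I * s * B) = c * A' + Complex.I * (τ * s) * B')
    (e₂ : G₁ * (c * A - Complex.I * s * B) = c * A' - Complex.I * (τ * s) * B')
    (e₃ : G₂ * (c * B + Complex.I * s * A) = c * B' + Complex.I * (τ * s) * A')
    (e₄ : G₂ * (c * B - Complex.I * s * A) = c * B' - Complex.I * (τ * s) * A') : A = 0 := by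
  have hc' : (c : ℂ) ≠ 0 := Complex.ofReal_ne_zero.mpr hc
  have hs' : (s : ℂ) ≠ 0 := Complex.ofReal_ne_zero.mpr hs
  have hτ' : (τ : ℂ) ^ 2 = 1 := by exact_mod_cast hτ
  have h1 : G₁ * A = A' := mul_left_cancel₀ hc' (by linear_combination (e₁ + e₂) / 2)
  have h2 : G₂ * A = τ * A' := mul_left_cancel₀ (mul_ne_zero Complex.I_ne_zero hs')
    (by linear_combination (e₃ - e₄) / 2)
  refine eq_zero_of_mul_sq_sub_sq hG ?_
  linear_combination (G₁ + τ * G₂) * h1 - (G₂ + τ * G₁) * h2 - A' * G₁ * hτ'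

theorem eq_zero_of_one_of_odd (hcs : c ^ 2 < s ^ 2) (hτ : τ ^ 2 = 1) (hG₁ : G₁ ≠ 0)
    (hG : ‖G₁‖ = ‖G₂‖)
    (e₁ : G₁ * (c * A + Complex.I * s * B) = c * A' + Complex.I * (τ * s) * B')
    (e₂ : -(G₁ * (c * A - Complex.I * s * B)) = c * A' - Complex.I * (τ * s) * B')
    (e₃ : G₂ * (c * B + Complex.I * s * A) = c * B' + Complex.I * (τ * s) * A')
    (e₄ : -(G₂ * (c * B - Complex.I * s * A)) = c * B' - Complex.I * (τ * s) * A') : A = 0 := by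
  have h1 : c * A * G₁ = Complex.I * (τ * s) * B' := by linear_combination (e₁ - e₂) / 2
  have h2 : Complex.I * s * G₂ * A = c * B' := by linear_combination (e₃ + e₄) / 2
  have h3 : A * (c ^ 2 * G₁) = A * (-τ * s ^ 2 * G₂) := by
    linear_combination c * h1 - Complex.I * τ * s * h2 + τ * s ^ 2 * A * G₂ * Complex.I_sq
  by_contra hA
  have h4 := congrArg norm (mul_left_cancel₀ hA h3)
  have hτ' : |τ| = 1 := by rwa [← sq_eq_sq₀ (abs_nonneg _) zero_le_one, sq_abs, one_pow]
  simp only [norm_mul, norm_neg, norm_pow, Complex.norm_real, Real.norm_eq_abs, hτ', sq_abs,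
    one_mul, ← hG] at h4
  exact hcs.ne (mul_right_cancel₀ (norm_ne_zero_iff.mpr hG₁) h4)

/-- The equations form a cycle `A → B' → B → A' → A`. Going around it, the factors `c` and `s`
cancel and `G₁² A = G₂² A` remains. -/
theorem eq_zero_of_I_of_even (hc : c ≠ 0) (hs : s ≠ 0) (hG : G₁ ^ 2 ≠ G₂ ^ 2)
    (e₁ : G₁ * (c * A + Complex.I * s * B) =
      Complex.I * (c * A' + Complex.I * (τ * s) * B'))
    (e₂ : G₁ * (c * A - Complex.I * s * B) =
      -Complex.I * (c * A' - Complex.I * (τ * s) * B'))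
    (e₃ : G₂ * (c * B + Complex.I * s * A) =
      Complex.I * (c * B' + Complex.I * (τ * s) * A'))
    (e₄ : -(G₂ * (c * B - Complex.I * s * A)) =
      -Complex.I * (c * B' - Complex.I * (τ * s) * A')) : A = 0 := by
  have hc' : (c : ℂ) ≠ 0 := Complex.ofReal_ne_zero.mpr hc
  have hs' : (s : ℂ) ≠ 0 := Complex.ofReal_ne_zero.mpr hs
  have h1 : G₁ * c * A = -τ * s * B' := by
    linear_combination (e₁ + e₂) / 2 + τ * s * B' * Complex.I_sq
  have h2 : G₁ * s * B = c * A' := mul_left_cancel₀ Complex.I_ne_zero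
    (by linear_combination (e₁ - e₂) / 2)
  have h3 : G₂ * Complex.I * A = -τ * A' := mul_left_cancel₀ hs'
    (by linear_combination (e₃ + e₄) / 2 + τ * s * A' * Complex.I_sq)
  have h4 : G₂ * B = Complex.I * B' := mul_left_cancel₀ hc'
    (by linear_combination (e₃ - e₄) / 2)
  refine eq_zero_of_mul_sq_sub_sq hG (mul_left_cancel₀ hc' ?_)
  linear_combination G₁ * h1 - Complex.I * τ * s * G₁ * h4 + Complex.I * τ * G₂ * h2 +
    Complex.I * c * G₂ * h3 - (c * G₂ ^ 2 * A + τ * s * G₁ * B') * Complex.I_sq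

theorem eq_zero_of_I_of_odd (hc : c ≠ 0) (hs : s ≠ 0) (hτ : τ ^ 2 = 1) (hG : G₁ ^ 2 ≠ G₂ ^ 2)
    (e₁ : G₁ * (c * A + Complex.I * s * B) =
      Complex.I * (c * A' + Complex.I * (τ * s) * B'))
    (e₂ : -(G₁ * (c * A - Complex.I * s * B)) =
      -Complex.I * (c * A' - Complex.I * (τ * s) * B'))
    (e₃ : G₂ * (c * B + Complex.I * s * A) =
      Complex.I * (c * B' + Complex.I * (τ * s) * A'))
    (e₄ : G₂ * (c * B - Complex.I * s * A) =
      -Complex.I * (c * B' - Complex.I * (τ * s) * A')) : A = 0 := by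
  have hc' : (c : ℂ) ≠ 0 := Complex.ofReal_ne_zero.mpr hc
  have hs' : (s : ℂ) ≠ 0 := Complex.ofReal_ne_zero.mpr hs
  have hτ' : (τ : ℂ) ^ 2 = 1 := by exact_mod_cast hτ
  have h1 : G₁ * A = Complex.I * A' := mul_left_cancel₀ hc'
    (by linear_combination (e₁ - e₂) / 2)
  have h2 : G₁ * Complex.I * B = -τ * B' := mul_left_cancel₀ hs'
    (by linear_combination (e₁ + e₂) / 2 + τ * s * B' * Complex.I_sq)
  have h3 : G₂ * c * B = -τ * s * A' := by
    linear_combination (e₃ + e₄) / 2 + τ * s * A' * Complex.I_sq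
  have h4 : G₂ * s * A = c * B' := mul_left_cancel₀ Complex.I_ne_zero
    (by linear_combination (e₃ - e₄) / 2)
  refine eq_zero_of_mul_sq_sub_sq hG (mul_left_cancel₀ hs' ?_)
  linear_combination s * G₁ * h1 - τ * c * G₂ * h2 + τ * Complex.I * G₁ * h3 - G₂ * h4 +
    (c * G₂ * B' - Complex.I * s * G₁ * A') * hτ'

/-- The final system for `p ≡ 1 mod 4`: real and imaginary parts at a square and at a nonsquare,
with `q = 1/√p`. The unknowns `w`, `w'` are the values of `u' - u 0` at the two points. -/
theorem eq_zero_and_eq_zero_of_re_im_eqs {b c d q s τ w w' : ℝ} (hc : c ≠ 0) (hs : s ≠ 0)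
    (hq : 0 < q) (hτ : τ ^ 2 = 1)
    (a₁ : -(q * (d * c)) + b * c * τ = w * c)
    (b₁ : -(q * (b * s)) + d * s * τ = w * (τ * s))
    (a₂ : -(q * (d * c)) + -(b * c * τ) = w' * c)
    (b₂ : -(q * (b * s)) + -(d * s * τ) = -(w' * (τ * s))) : d = 0 ∧ b = 0 := by
  have a₁' : w = -(q * d) + b * τ := mul_right_cancel₀ hc (by linear_combination -a₁)
  have b₁' : -(q * b) + d * τ = w * τ := mul_right_cancel₀ hs (by linear_combination b₁)
  have a₂' : w' = -(q * d) - b * τ := mul_right_cancel₀ hc (by linear_combination -a₂)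
  have b₂' : q * b + d * τ = w' * τ := mul_right_cancel₀ hs (by linear_combination -b₂)
  rw [a₁'] at b₁'
  rw [a₂'] at b₂'
  have hq' : 1 + q ≠ 0 := by positivity
  have hb : b = 0 := mul_left_cancel₀ hq' (by linear_combination (b₂' - b₁') / 2 - b * hτ)
  have hd : d * τ = 0 := mul_left_cancel₀ hq' (by linear_combination (b₂' + b₁') / 2)
  refine ⟨(mul_eq_zero.mp hd).resolve_right ?_, hb⟩
  rintro rfl
  norm_num at hτ

/-- The counterpart for `p ≡ 3 mod 4`. With `s = √p c` the system reduces to `d = -b` and `d = p b`.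
-/
theorem eq_zero_and_eq_zero_of_re_im_eqs' {b c d r s τ w w' : ℝ} (hc : c ≠ 0) (hr : r ≠ 0)
    (hτ : τ ^ 2 = 1) (hs : s = r * c)
    (a₁ : -(r⁻¹ * (d * c)) + -(d * s * τ) = -(w * (τ * s)))
    (b₁ : -(r⁻¹ * (b * s)) + b * c * τ = w * c)
    (a₂ : -(r⁻¹ * (d * c)) + d * s * τ = w' * (τ * s))
    (b₂ : -(r⁻¹ * (b * s)) + -(b * c * τ) = w' * c) : d = 0 ∧ b = 0 := by
  have hri : r⁻¹ * r = 1 := inv_mul_cancel₀ hr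
  subst hs
  have b₁' : w = -b + b * τ := mul_right_cancel₀ hc (by linear_combination -b₁ - b * c * hri)
  have b₂' : w' = -b - b * τ := mul_right_cancel₀ hc (by linear_combination -b₂ - b * c * hri)
  rw [b₁'] at a₁
  rw [b₂'] at a₂
  have hτ0 : τ ≠ 0 := by
    rintro rfl
    norm_num at hτ
  have h1 : d = -b := mul_right_cancel₀ (mul_ne_zero (mul_ne_zero hc hr) hτ0)
    (by linear_combination (a₂ - a₁) / 2)
  have h2 : d = r ^ 2 * b := mul_right_cancel₀ hc
    (by linear_combination -r * (a₁ + a₂) / 2 - d * c * hri + r ^ 2 * b * c * hτ)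
  have hb : b = 0 := mul_left_cancel₀ (show 1 + r ^ 2 ≠ 0 by positivity)
    (by linear_combination h1 - h2)
  exact ⟨by rw [h1, hb, neg_zero], hb⟩

end Algebra

/-! ### Rigidity: the real multipliers are constant. -/

theorem sum_mul_inv_eq_zero (hp : 3 ≤ p) {u u' : ZMod p → ℝ}
    (hF : ∀ k, fourier p (fun x => (u x : ℂ) * h₀ p x) k = u' k * fourier p (h₀ p) k)
    {ψ : MulChar (ZMod p) ℂ} (hψ : ψ ≠ 1) (hψ' : ψ ≠ legendreChar p) :
    ∑ x, (u x : ℂ) * ψ⁻¹ x = 0 := by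
  obtain ⟨τ, hτ, hg⟩ := exists_gaussSum_legendreChar_eq hp
  have hφ : ψ * legendreChar p ≠ 1 := fun h => hψ' <| by
    rw [← mul_one ψ, ← legendreChar_mul_legendreChar, ← mul_assoc, h, one_mul]
  have hr : ((Real.sqrt p : ℝ) : ℂ)⁻¹ ≠ 0 := inv_ne_zero ofReal_sqrt_ne_zero
  have e₁ := mellin_eq hp hg hF hψ
  have e₂ := mellin_star_eq hp hg hF hψ
  -- As `χ₀² = 1`, replacing `ψ` by `ψ χ₀` exchanges the two sums on each side, so four equations in
  -- four unknowns result.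
  have e₃ := mellin_eq hp hg hF hφ
  have e₄ := mellin_star_eq hp hg hF hφ
  have hinv : (ψ * legendreChar p)⁻¹ = ψ⁻¹ * legendreChar p := by
    rw [mul_inv, legendreChar_isQuadratic.inv]
  simp only [hinv, mul_assoc ψ⁻¹, mul_assoc ψ, legendreChar_mul_legendreChar, mul_one] at e₃ e₄
  have hG : (((Real.sqrt p : ℝ) : ℂ)⁻¹ * gaussSum ψ (ZMod.stdAddChar (N := p))) ^ 2 ≠
      (((Real.sqrt p : ℝ) : ℂ)⁻¹ *
        gaussSum (ψ * legendreChar p) (ZMod.stdAddChar (N := p))) ^ 2 := by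
    rw [mul_pow, mul_pow]
    exact fun h => gaussSum_sq_ne hp hψ (mul_left_cancel₀ (pow_ne_zero 2 hr) h)
  have hc := (cos_theta_pos (p := p)).ne'
  have hs := sin_theta_ne_zero hp
  rw [MulChar.mul_apply] at e₄
  rcases mod_four_eq_one_or_three hp with h | h <;>
    rcases mulChar_neg_one_eq ψ with hε | hε
  · simp only [hε, legendreChar_neg_one_of_mod_four_eq_one hp h, gaussUnit, if_pos h, star_one,
      one_mul] at e₁ e₂ e₃ e₄
    exact eq_zero_of_one_of_even hc hs hτ hG e₁ e₂ e₃ e₄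
  · simp only [hε, legendreChar_neg_one_of_mod_four_eq_one hp h, gaussUnit, if_pos h, star_one,
      one_mul, mul_one, neg_mul] at e₁ e₂ e₃ e₄
    refine eq_zero_of_one_of_odd (cos_sq_ne_sin_sq h) hτ (mul_ne_zero hr (gaussSum_ne_zero hψ)) ?_
      e₁ e₂ e₃ e₄
    rw [norm_mul, norm_mul, norm_gaussSum_eq hψ hφ]
  · have h' : ¬ p % 4 = 1 := by omega
    simp only [hε, legendreChar_neg_one_of_mod_four_eq_three hp h, gaussUnit, if_neg h',
      Complex.star_def, Complex.conj_I, one_mul, neg_one_mul] at e₁ e₂ e₃ e₄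
    exact eq_zero_of_I_of_even hc hs hG e₁ e₂ e₃ e₄
  · have h' : ¬ p % 4 = 1 := by omega
    simp only [hε, legendreChar_neg_one_of_mod_four_eq_three hp h, gaussUnit, if_neg h',
      Complex.star_def, Complex.conj_I, one_mul, neg_one_mul, neg_neg] at e₁ e₂ e₃ e₄
    exact eq_zero_of_I_of_odd hc hs hτ hG e₁ e₂ e₃ e₄

/-- If the products of `h₀` and of its Fourier transform with real functions correspond to each
other under the Fourier transform, then these functions are constant. -/
theorem eq_const_of_fourier_mul_h₀ (hp : 3 ≤ p) {u u' : ZMod p → ℝ}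
    (hF : ∀ k, fourier p (fun x => (u x : ℂ) * h₀ p x) k = u' k * fourier p (h₀ p) k)
    (x : ZMod p) : u x = u 0 := by
  obtain ⟨τ, hτ, hg⟩ := exists_gaussSum_legendreChar_eq hp
  obtain ⟨a, b, hab⟩ := exists_eq_add_mul_quadraticChar hp u
    fun ψ hψ hψ' => sum_mul_inv_eq_zero hp hF hψ hψ'
  set c := Real.cos (theta p) with hc
  set s := Real.sin (theta p) with hs
  set d := a - u 0 with hd
  -- Subtracting `u 0 • h₀` kills the value at `0`; off `0` this is the product `(d + b χ₀)(c + i s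
  -- χ₀)` expanded with `χ₀² = 1`.
  have hv : (fun x => (u x : ℂ) * h₀ p x) - (u 0 : ℂ) • h₀ p = fun x =>
      0 * (if x = 0 then 1 else 0) + (d * c + Complex.I * b * s : ℂ) * (if x = 0 then 0 else 1) +
      (b * c + Complex.I * d * s : ℂ) * legendreChar p x := by
    funext y
    by_cases hy : y = 0
    · simp [hy, MulChar.map_zero]
    · have h1 := legendreChar_mul_self hy
      simp only [Pi.sub_apply, Pi.smul_apply, smul_eq_mul, hy, if_false, h₀_apply hy, hab y hy, hd]
      rw [legendreChar_apply] at h1 ⊢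
      simp only [Complex.ofReal_add, Complex.ofReal_sub, Complex.ofReal_mul, Complex.ofReal_intCast]
      linear_combination (Complex.I * b * s) * h1
  have key : ∀ k : ZMod p, k ≠ 0 →
      -((Real.sqrt p : ℝ) : ℂ)⁻¹ * (d * c + Complex.I * b * s) +
        (b * c + Complex.I * d * s) * (τ * gaussUnit p) * legendreChar p k =
      (u' k - u 0 : ℝ) * (gaussUnit p * (c + Complex.I * (τ * s) * legendreChar p k)) := by
    intro k hk
    have h1 := congrFun (congrArg (fourier p) hv) k
    rw [map_sub, map_smul, Pi.sub_apply, Pi.smul_apply, hF, smul_eq_mul, fourier_h₀_apply hp hg hk,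
      fourier_delta_add_one_add_legendreChar hp, if_neg hk] at h1
    push_cast
    linear_combination -h1 - (b * c + Complex.I * d * s) * legendreChar p k * hg
  obtain ⟨t, ht⟩ := quadraticChar_exists_neg_one' (ringChar_ne_two hp)
  have k₁ := key 1 one_ne_zero
  have k₂ := key t t.ne_zero
  rw [map_one, mul_one, mul_one] at k₁
  rw [legendreChar_apply, ht] at k₂
  have hcp : 0 < c := cos_theta_pos
  have hsp : 1 < Real.sqrt p := one_lt_sqrt
  set r := Real.sqrt p with hr
  suffices h : d = 0 ∧ b = 0 by
    by_cases hx : x = 0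
    · rw [hx]
    · rw [hab x hx, h.2]
      linarith [h.1]
  rw [← Complex.ofReal_inv] at k₁ k₂
  have hri0 : 0 < r⁻¹ := by positivity
  rcases mod_four_eq_one_or_three hp with h | h
  · rw [gaussUnit, if_pos h] at k₁ k₂
    have a₁ := congrArg Complex.re k₁
    have b₁ := congrArg Complex.im k₁
    have a₂ := congrArg Complex.re k₂
    have b₂ := congrArg Complex.im k₂
    simp at a₁ b₁ a₂ b₂
    exact eq_zero_and_eq_zero_of_re_im_eqs hcp.ne' (sin_theta_ne_zero hp) hri0 hτ a₁ b₁ a₂ b₂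
  · have hsc : s = r * c := sin_theta_eq h
    rw [gaussUnit, if_neg (by omega)] at k₁ k₂
    have a₁ := congrArg Complex.re k₁
    have b₁ := congrArg Complex.im k₁
    have a₂ := congrArg Complex.re k₂
    have b₂ := congrArg Complex.im k₂
    simp at a₁ b₁ a₂ b₂
    exact eq_zero_and_eq_zero_of_re_im_eqs' hcp.ne' (by linarith) hτ hsc a₁ b₁ a₂ b₂

/-! ### Tangent vectors as infinitesimal phase changes. -/

section Tangent

variable {V : Type*} [NormedAddCommGroup V] [NormedSpace ℂ V] {N : ℕ} [NeZero N]

theorem hasDerivAt_normSq_comp {g : ℝ → ℂ} {g' : ℂ} {t : ℝ} (hg : HasDerivAt g g' t) :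
    HasDerivAt (fun t => ‖g t‖ ^ 2) (2 * (g' * star (g t)).re) t := by
  have := hg.norm_sq
  convert this using 1
  simp [Complex.inner, mul_comm]

/-- A tangent vector at `h` to a set of lines whose images under the linear map `L` are in the
Clifford torus comes from a vector that `L` maps to an imaginary multiple of `L h`. -/
theorem exists_of_mem_tangentSpace (S : Set (ℙ ℂ V))
    (L : V →L[ℂ] (ZMod N → ℂ))
    (hS : ∀ (v : V) (hv : v ≠ 0), Projectivization.mk ℂ v hv ∈ S →
      ∀ k, ‖L v k‖ = ‖L v 0‖)
    (h : V) (hh : h ≠ 0) (hL : ∀ k, L h k ≠ 0)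
    (hm : h ∈ (Projectivization.mk ℂ h hh).submodule)
    (φ : (Projectivization.mk ℂ h hh).submodule →ₗ[ℂ]
      (V ⧸ (Projectivization.mk ℂ h hh).submodule))
    (hφ : φ ∈ tangentSpace S (Projectivization.mk ℂ h hh)) :
    ∃ (w : V) (u : ZMod N → ℝ), φ ⟨h, hm⟩ = Submodule.Quotient.mk w ∧
      ∀ k, L w k = Complex.I * (u k * L h k) := by
  induction hφ using Submodule.span_induction with
  | zero => exact ⟨0, 0, rfl, by simp⟩
  | add φ₁ φ₂ _ _ h₁ h₂ =>
    obtain ⟨w₁, u₁, e₁, f₁⟩ := h₁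
    obtain ⟨w₂, u₂, e₂, f₂⟩ := h₂
    refine ⟨w₁ + w₂, u₁ + u₂, congrArg₂ (· + ·) e₁ e₂, fun k => ?_⟩
    simp only [map_add, Pi.add_apply, f₁, f₂, Complex.ofReal_add]
    ring
  | smul a φ₁ _ h₁ =>
    obtain ⟨w₁, u₁, e₁, f₁⟩ := h₁
    refine ⟨(a : ℂ) • w₁, a • u₁, ?_, fun k => ?_⟩
    · rw [Submodule.Quotient.mk_smul, ← e₁]
      exact (Complex.coe_smul a _).symm
    · simp only [map_smul, Pi.smul_apply, smul_eq_mul, f₁, Complex.ofReal_mul]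
      ring
  | mem φ hφ =>
    obtain ⟨γ, hγ, hx, hsm, hmem, heq⟩ := hφ
    obtain ⟨c, hc⟩ : ∃ c : ℂ, c • h = γ 0 := by
      rw [Projectivization.submodule_mk] at hx
      exact Submodule.mem_span_singleton.mp hx
    have hc0 : c ≠ 0 := by
      rintro rfl
      exact hγ 0 (by rw [← hc, zero_smul])
    have hd : HasDerivAt γ (deriv γ 0) 0 :=
      (hsm.differentiable one_ne_zero).differentiableAt.hasDerivAt
    have hLγ : HasDerivAt (fun t => L (γ t)) (L (deriv γ 0)) 0 :=
      (L.restrictScalars ℝ).hasFDerivAt.comp_hasDerivAt (0 : ℝ) hd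
    have hLd : ∀ k, HasDerivAt (fun t => L (γ t) k) (L (deriv γ 0) k) 0 := hasDerivAt_pi.mp hLγ
    -- The logarithmic derivative of each coordinate of `L ∘ γ` at `0`. The coordinates keep equal
    -- moduli along the curve, so its real part does not depend on `k`.
    set g : ZMod N → ℂ := fun k => L (deriv γ 0) k / (c * L h k) with hg
    have hL0 : ∀ k, L (γ 0) k = c * L h k := fun k => by
      rw [← hc, map_smul, Pi.smul_apply, smul_eq_mul]
    have hLg : ∀ k, L (deriv γ 0) k = g k * (c * L h k) := fun k =>
      (div_mul_cancel₀ _ (mul_ne_zero hc0 (hL k))).symm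
    have hnorm : ∀ k, ‖c * L h k‖ = ‖c * L h 0‖ := fun k => by
      rw [← hL0, ← hL0]
      exact hS _ (hγ 0) (hmem 0) k
    have hre : ∀ k, (g k).re = (g 0).re := fun k => by
      have e1 := hasDerivAt_normSq_comp (hLd k)
      have e2 := hasDerivAt_normSq_comp (hLd 0)
      have e3 : (fun t => ‖L (γ t) k‖ ^ 2) = fun t => ‖L (γ t) 0‖ ^ 2 := by
        funext t
        rw [hS _ (hγ t) (hmem t) k]
      rw [e3] at e1
      have e4 := e1.unique e2
      have e5 : ∀ j, (L (deriv γ 0) j * star (L (γ 0) j)).re = (g j).re * ‖c * L h 0‖ ^ 2 :=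
        fun j => by
          rw [hL0, hLg, mul_assoc, Complex.star_def, Complex.mul_conj, Complex.re_mul_ofReal,
            Complex.normSq_eq_norm_sq, hnorm]
      rw [e5, e5] at e4
      have : ‖c * L h 0‖ ^ 2 ≠ 0 :=
        pow_ne_zero 2 (norm_ne_zero_iff.mpr (mul_ne_zero hc0 (hL 0)))
      exact mul_right_cancel₀ this (mul_left_cancel₀ two_ne_zero e4)
    -- Dividing by `c` moves the base vector from `γ 0` to `h`; subtracting the common real part
    -- times `h` leaves the class unchanged and makes the multipliers purely imaginary.
    refine ⟨c⁻¹ • (deriv γ 0) - ((g 0).re : ℂ) • h, fun k => (g k).im, ?_, fun k => ?_⟩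
    · have e1 : (⟨γ 0, hx⟩ : (Projectivization.mk ℂ h hh).submodule) = c • ⟨h, hm⟩ :=
        Subtype.ext hc.symm
      rw [e1, map_smul, Submodule.mkQ_apply] at heq
      have e2 : (Submodule.Quotient.mk (((g 0).re : ℂ) • h) :
          V ⧸ (Projectivization.mk ℂ h hh).submodule) = 0 :=
        (Submodule.Quotient.mk_eq_zero _).mpr (Submodule.smul_mem _ _ hm)
      rw [Submodule.Quotient.mk_sub, e2, sub_zero, Submodule.Quotient.mk_smul, ← heq, smul_smul,
        inv_mul_cancel₀ hc0, one_smul]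
    · simp only [map_sub, map_smul, Pi.sub_apply, Pi.smul_apply, smul_eq_mul, hLg]
      rw [← hre k]
      have h1 := Complex.re_add_im (g k)
      have h2 : c⁻¹ * c = 1 := inv_mul_cancel₀ hc0
      clear_value g
      linear_combination g k * L h k * h2 - L h k * h1

/-- A tangent vector is determined by its value at `h`, so it suffices that any two representatives
of this value, one of each type, lie on the line of `h`. The maps `L` and `L'` will be the identity
and `F`. -/
theorem isTransverseAt_of_forall_mem_span {S S' : Set (ℙ ℂ V)} {L L' : V →L[ℂ] (ZMod N → ℂ)}
    (hS : ∀ (v : V) (hv : v ≠ 0), Projectivization.mk ℂ v hv ∈ S → ∀ k, ‖L v k‖ = ‖L v 0‖)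
    (hS' : ∀ (v : V) (hv : v ≠ 0), Projectivization.mk ℂ v hv ∈ S' → ∀ k, ‖L' v k‖ = ‖L' v 0‖)
    {h : V} (hh : h ≠ 0) (hL : ∀ k, L h k ≠ 0) (hL' : ∀ k, L' h k ≠ 0)
    (hmem : Projectivization.mk ℂ h hh ∈ S ∩ S')
    (hspan : ∀ (w w' : V) (u u' : ZMod N → ℝ), (∀ k, L w k = Complex.I * (u k * L h k)) →
      (∀ k, L' w' k = Complex.I * (u' k * L' h k)) → w - w' ∈ Submodule.span ℂ {h} →
      w ∈ Submodule.span ℂ {h}) :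
    IsTransverseAt S S' (Projectivization.mk ℂ h hh) := by
  refine ⟨hmem, eq_bot_iff.mpr ?_⟩
  rintro φ ⟨hφ, hφ'⟩
  have hm : h ∈ (Projectivization.mk ℂ h hh).submodule := by
    rw [Projectivization.submodule_mk]
    exact Submodule.mem_span_singleton_self _
  obtain ⟨w, u, e, f⟩ := exists_of_mem_tangentSpace S L hS h hh hL hm φ hφ
  obtain ⟨w', u', e', f'⟩ := exists_of_mem_tangentSpace S' L' hS' h hh hL' hm φ hφ'
  have hw := (Submodule.Quotient.eq _).mp (e.symm.trans e')
  have hφh : φ ⟨h, hm⟩ = 0 := by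
    rw [e, Submodule.Quotient.mk_eq_zero]
    rw [Projectivization.submodule_mk] at hw ⊢
    exact hspan w w' u u' f f' hw
  rw [Submodule.mem_bot]
  refine LinearMap.ext fun ⟨v, hv⟩ => ?_
  obtain ⟨c, rfl⟩ : ∃ c : ℂ, c • h = v := by
    rw [Projectivization.submodule_mk] at hv
    exact Submodule.mem_span_singleton.mp hv
  have : (⟨c • h, hv⟩ : (Projectivization.mk ℂ h hh).submodule) = c • ⟨h, hm⟩ := rfl
  rw [this, map_smul, hφh, smul_zero]
  rfl

end Tangent

/-! ### From tangent vectors to real multipliers, and conclusion. -/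

theorem mk_mem_cliffordTorus_iff {N : ℕ} {f : ZMod N → ℂ} (hf : f ≠ 0) :
    Projectivization.mk ℂ f hf ∈ cliffordTorus N ↔ ∀ k, ‖f k‖ = ‖f 0‖ := by
  simp only [cliffordTorus, Set.mem_ofPred_eq, Projectivization.submodule_mk]
  refine ⟨fun h => h f (Submodule.mem_span_singleton_self f), fun h g hg k => ?_⟩
  obtain ⟨c, rfl⟩ := Submodule.mem_span_singleton.mp hg
  simp [h k]

theorem projFourier_mk {N : ℕ} [NeZero N] {f : ZMod N → ℂ} (hf : f ≠ 0) :
    projFourier N (Projectivization.mk ℂ f hf) = Projectivization.mk ℂ (fourier N f)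
      ((map_ne_zero_iff _ (fourier_injective N)).mpr hf) :=
  Projectivization.map_mk _ _ _ _

theorem mem_span_h₀_of_sub_mem_span {p : ℕ} [Fact p.Prime] (hp : 3 ≤ p) {w w' : ZMod p → ℂ}
    {u u' : ZMod p → ℝ} (f : ∀ k, w k = Complex.I * (u k * h₀ p k))
    (f' : ∀ k, fourier p w' k = Complex.I * (u' k * fourier p (h₀ p) k))
    (hw : w - w' ∈ Submodule.span ℂ {h₀ p}) : w ∈ Submodule.span ℂ {h₀ p} := by
  obtain ⟨l, hl⟩ := Submodule.mem_span_singleton.mp hw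
  have hwu : w = Complex.I • fun x => (u x : ℂ) * h₀ p x := by
    funext k
    rw [f k, Pi.smul_apply, smul_eq_mul]
  have hF : ∀ k, fourier p (fun x => (u x : ℂ) * h₀ p x) k =
      (u' k + -Complex.I * l) * fourier p (h₀ p) k := fun k => by
    have := congrFun (congrArg (fourier p) hl) k
    rw [map_sub, hwu, map_smul, map_smul, Pi.sub_apply, Pi.smul_apply, Pi.smul_apply, smul_eq_mul,
      smul_eq_mul, f' k] at this
    refine mul_left_cancel₀ Complex.I_ne_zero ?_
    linear_combination -this + l * fourier p (h₀ p) k * Complex.I_sq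
  -- By Parseval and unimodularity, `∑ u = ∑ (u' - i l)`, and every other term is real.
  have him : (-Complex.I * l).im = 0 := by
    have h1 := sum_fourier_mul_star_fourier (fun x => (u x : ℂ) * h₀ p x) (h₀ p)
    have h2 : ∀ z : ℂ, ‖z‖ = 1 → z * star z = 1 := fun z hz => by
      rw [Complex.star_def, Complex.mul_conj, Complex.normSq_eq_norm_sq, hz]
      simp
    simp only [hF, mul_assoc, h2 _ (norm_h₀ _), h2 _ (norm_fourier_h₀ hp _), mul_one] at h1
    have h3 := congrArg Complex.im h1
    simp only [Complex.im_sum, Complex.add_im, Complex.ofReal_im, zero_add, Finset.sum_const,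
      Finset.card_univ, ZMod.card, smul_zero, nsmul_eq_mul] at h3
    exact (mul_eq_zero.mp h3).resolve_left (by exact_mod_cast (Fact.out : p.Prime).ne_zero)
  have hF' : ∀ k, fourier p (fun x => (u x : ℂ) * h₀ p x) k =
      (u' k + (-Complex.I * l).re : ℝ) * fourier p (h₀ p) k := fun k => by
    rw [hF, Complex.ofReal_add]
    congr 2
    exact Complex.ext rfl (by rw [him, Complex.ofReal_im])
  have hu := eq_const_of_fourier_mul_h₀ hp hF'
  refine Submodule.mem_span_singleton.mpr ⟨Complex.I * u 0, ?_⟩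
  funext k
  rw [f k, hu k, Pi.smul_apply, smul_eq_mul, mul_assoc]

end BjorckSaffari

theorem propositionA3 (p : ℕ) [Fact p.Prime] (hp : 3 ≤ p) :
    BjorckSaffari.IsTransverseAt
      (BjorckSaffari.cliffordTorus p)
      (BjorckSaffari.projFourier p ⁻¹' BjorckSaffari.cliffordTorus p)
      (Projectivization.mk ℂ (BjorckSaffari.h₀ p) (BjorckSaffari.h₀_ne_zero p)) := by
  refine BjorckSaffari.isTransverseAt_of_forall_mem_span (L := ContinuousLinearMap.id ℂ (ZMod p → ℂ))
    (L' := LinearMap.toContinuousLinearMap (BjorckSaffari.fourier p))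
    (fun v hv h => (BjorckSaffari.mk_mem_cliffordTorus_iff hv).mp h)
    (fun v hv h => by
      rw [Set.mem_preimage, BjorckSaffari.projFourier_mk, BjorckSaffari.mk_mem_cliffordTorus_iff] at h
      exact h) _
    (fun k => norm_ne_zero_iff.mp (by simp [BjorckSaffari.norm_h₀]))
    (fun k => norm_ne_zero_iff.mp (by simp [BjorckSaffari.norm_fourier_h₀ hp])) ⟨?_, ?_⟩ ?_
  · exact (BjorckSaffari.mk_mem_cliffordTorus_iff _).mpr fun k => by rw [BjorckSaffari.norm_h₀, BjorckSaffari.norm_h₀]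
  · rw [Set.mem_preimage, BjorckSaffari.projFourier_mk, BjorckSaffari.mk_mem_cliffordTorus_iff]
    exact fun k => by rw [BjorckSaffari.norm_fourier_h₀ hp, BjorckSaffari.norm_fourier_h₀ hp]
  · intro w w' u u' f f' hw
    exact BjorckSaffari.mem_span_h₀_of_sub_mem_span hp f f' hw
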